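/- Let $H$ be a solvable permutation group on a finite non-empty set $\Omega$ (that is, a solvable subgroup of $\mathrm{Sym}(\Omega)$). For a subset $\Delta\subseteq\Omega$ let $H_\Delta=\{h\in H : h(\Delta)=\Delta\}$ be its setwise stabilizer, let $\pi(H)$ be the set of prime divisors of $|H|$, and let $\pi(H:H_\Delta)$ be the set of prime divisors of the index $|H:H_\Delta|$. Then there exists a non-empty subset $\Delta\subseteq\Omega$ such that (a) $\pi(H)\subseteq\pi(H:H_\Delta)\cup\{p\}$ for some $p\in\{2,3\}$; and (b) if $|H|$ is odd, then $\pi(H)=\pi(H:H_\Delta)$. -/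

import Mathlib

open scoped Pointwise

/-- The set of prime divisors of the order of a (finite) group. -/
noncomputable def primesOfGroup (G : Type*) [Group G] : Finset ℕ := (Nat.card G).primeFactors

/-- The set of prime divisors of the index of a subgroup (of a finite group). -/
noncomputable def primesOfIndex {G : Type*} [Group G] (S : Subgroup G) : Finset ℕ := S.index.primeFactors

/-!
The proof is an induction on the degree, over arbitrary actions of finite solvable groups; the
classification of primitive solvable groups is not needed. The order of the permutation group
induced by `G` on `Ω` is the index of the kernel of the action, and the claim about the action of
`G` on `Ω` is `HasCoveringSubset G Ω`.

If `G` is intransitive, `Ω` is the union of two smaller invariant sets, and subsets that are good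
for the two actions are united (`HasCoveringSubset.of_compl`). The exceptional primes of the two
parts do not add up: a part which misses `3` either has odd order, and then misses nothing, or
provides the prime `2` (`NearlyCovers.combine`).

If `G` is transitive and faithful, it has a nontrivial normal elementary abelian `q`-subgroup `N`.
If `N` is intransitive, its orbits form a system of blocks. With `K` the kernel of the action on the
blocks, the induction hypothesis gives a set `A` of blocks, for `G`, and a subset `S` of one block,
for `K`. Put a translate of `S` into each block in `A`: the orbit length of the union is divisible
by those of `A` and of `S`, the latter because `K` is normal (`HasCoveringSubset.of_block`).

If `N` is transitive, it is regular, so that `Ω` may be identified with `N`, written additively as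
`V`, and `G` acts by affine permutations of `V` (`HasCoveringSubset.of_regular`). A proper nonempty
subset `T` of `V` is not `N`-invariant, whence `q` divides its orbit length. It remains to find `T`
that no nontrivial affine permutation of prime order `r` stabilises, for all `r ≠ q` apart from
`r = 2` if `q` is odd, and `r = 3` if `q = 2`. Such a `T` is built along a chain of subgroups of `V`
in such a way that the chain can be recovered from `T` (`Pins`): a permutation stabilising `T`
stabilises the chain, and if it has order prime to `q` and acts trivially on the bottom and on each
quotient of consecutive terms, it is trivial. For odd `q` one passes from `T ⊂ W` to `T ∪ (c + W)`,
starting with two points; for `q = 2` to the complement of `T` in `W ∪ (c + W)`, starting with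
three points.
-/

/-! ### Rigid subsets of elementary abelian groups -/

theorem apply_mem_iff_of_mapsTo {α : Type*} [Finite α] {g : Equiv.Perm α} {S : Set α}
    (h : ∀ x ∈ S, g x ∈ S) (x : α) : g x ∈ S ↔ x ∈ S := by
  refine ⟨fun hx => ?_, h x⟩
  simpa using Equiv.Perm.perm_symm_on_of_perm_on_finite (f := g) (p := fun y => y ∈ S)
    (fun {y} => h y) hx

/-- A cycle of prime length `r` does not fit into an invariant set of fewer than `r` points. -/
theorem fixed_of_pow_eq_one {α : Type*} {g : Equiv.Perm α} {r : ℕ} (hr : r.Prime)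
    (hg : g ^ r = 1) (F : Finset α) (hF : F.card < r) (h : ∀ x ∈ F, g x ∈ F) {x : α}
    (hx : x ∈ F) : g x = x := by
  have hp : Function.IsPeriodicPt g r x := by
    rw [Function.IsPeriodicPt, Function.IsFixedPt, Equiv.Perm.iterate_eq_pow, hg]; rfl
  rcases (Nat.dvd_prime hr).1 hp.minimalPeriod_dvd with h1 | h1
  · exact Function.minimalPeriod_eq_one_iff_isFixedPt.1 h1
  · exfalso
    have hmem : ∀ n, g^[n] x ∈ F := fun n => by
      induction n with
      | zero => exact hx
      | succ n ih => rw [Function.iterate_succ_apply']; exact h _ ih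
    have hc : (Finset.range r).card ≤ F.card :=
      Finset.card_le_card_of_injOn (fun n => g^[n] x) (fun n _ => hmem n) (by
        intro a ha b hb hab
        have := Function.iterate_injOn_Iio_minimalPeriod (f := g) (x := x)
        rw [h1] at this
        exact this (by simpa using ha) (by simpa using hb) hab)
    simp at hc; omega

section Affine

variable {V : Type*} [AddCommGroup V]

/-- A permutation of an additive abelian group is affine if it is an endomorphism followed by a
translation; as the permutation is bijective, the endomorphism is an automorphism. -/
def IsAffinePerm (g : Equiv.Perm V) : Prop := ∃ L : V →+ V, ∀ x, g x = L x + g 0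

theorem IsAffinePerm.apply_add_sub {g : Equiv.Perm V} (hg : IsAffinePerm g) (a b c : V) :
    g (a + b - c) = g a + g b - g c := by
  obtain ⟨L, hL⟩ := hg
  rw [hL (a + b - c), hL a, hL b, hL c, map_sub, map_add]; abel

/-- `T` pins the subgroup `W` for the primes satisfying `P`: every affine permutation stabilising
`T` stabilises `W`, and it fixes `W` pointwise if its `n`-th power is trivial for such a prime
`n`. -/
def Pins (P : ℕ → Prop) (T : Set V) (W : AddSubgroup V) : Prop :=
  ∀ g : Equiv.Perm V, IsAffinePerm g → (∀ x, g x ∈ T ↔ x ∈ T) →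
    (∀ x ∈ W, g x ∈ W) ∧ ∀ n, n.Prime → P n → g ^ n = 1 → ∀ x ∈ W, g x = x

theorem mem_of_nsmul_mem {q n : ℕ} (hn : n.Coprime q) (hV : ∀ v : V, q • v = 0)
    {W : AddSubgroup V} {x : V} (h : n • x ∈ W) : x ∈ W := by
  have h1 : ((Nat.gcd n q : ℕ) : ℤ) • x ∈ W := by
    rw [Nat.gcd_eq_gcd_ab, add_smul, mul_comm, mul_smul, mul_comm, mul_smul]
    simp only [natCast_zsmul, hV, smul_zero, add_zero]
    exact W.zsmul_mem h _
  simpa [Nat.Coprime.gcd_eq_one hn] using h1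

/-- An affine permutation of order prime to the exponent that fixes `W` pointwise and maps `c` into
`c + W` fixes `c`: it acts on `c + W` as a translation, whose order divides the exponent. -/
theorem fixed_of_fixed_subgroup {q n : ℕ} (hn : n.Coprime q) (hV : ∀ v : V, q • v = 0)
    {W : AddSubgroup V} {g : Equiv.Perm V} (hg : IsAffinePerm g) (hW : ∀ x ∈ W, g x = x)
    (hgn : g ^ n = 1) {c : V} (hc : g c - c ∈ W) : g c = c := by
  have key : ∀ k : ℕ, (g ^ k) c = c + k • (g c - c) := by
    intro k
    induction k with
    | zero => simp
    | succ k ih =>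
      rw [pow_succ', Equiv.Perm.mul_apply, ih]
      have := hg.apply_add_sub c (k • (g c - c)) 0
      rw [sub_zero] at this
      rw [this, hW _ (W.nsmul_mem hc k), hW 0 W.zero_mem, succ_nsmul]; abel
  have h := key n
  rw [hgn, Equiv.Perm.one_apply, left_eq_add] at h
  have : g c - c ∈ (⊥ : AddSubgroup V) := mem_of_nsmul_mem hn hV (by rw [h]; exact zero_mem _)
  rw [AddSubgroup.mem_bot, sub_eq_zero] at this
  exact this

theorem mapsTo_sup_zmultiples {W : AddSubgroup V} {g : Equiv.Perm V} (hg : IsAffinePerm g)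
    (hW : ∀ x ∈ W, g x ∈ W) {c : V} (hc : g c ∈ W ⊔ AddSubgroup.zmultiples c) :
    ∀ x ∈ W ⊔ AddSubgroup.zmultiples c, g x ∈ W ⊔ AddSubgroup.zmultiples c := by
  obtain ⟨L, hL⟩ := hg
  have h0 : g 0 ∈ W := hW 0 W.zero_mem
  have h0' := AddSubgroup.mem_sup_left (T := AddSubgroup.zmultiples c) h0
  have hLc : L c ∈ W ⊔ AddSubgroup.zmultiples c := by
    rw [hL] at hc; simpa using sub_mem hc h0'
  have hle : W ⊔ AddSubgroup.zmultiples c ≤ (W ⊔ AddSubgroup.zmultiples c).comap L := by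
    refine sup_le (fun w hw => ?_) (by simpa using hLc)
    have := hW w hw
    rw [hL] at this
    refine AddSubgroup.mem_sup_left ?_
    simpa using sub_mem this h0
  intro x hx
  rw [hL]; exact add_mem (hle hx) h0'

theorem fixed_sup_zmultiples {W : AddSubgroup V} {g : Equiv.Perm V} (hg : IsAffinePerm g)
    (hW : ∀ x ∈ W, g x = x) {c : V} (hc : g c = c) :
    ∀ x ∈ W ⊔ AddSubgroup.zmultiples c, g x = x := by
  obtain ⟨L, hL⟩ := hg
  have h0 : g 0 = 0 := hW 0 W.zero_mem
  simp only [h0, add_zero] at hL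
  have hle : W ⊔ AddSubgroup.zmultiples c ≤ L.eqLocus (AddMonoidHom.id V) := by
    refine sup_le (fun w hw => ?_) (by
      rw [AddSubgroup.zmultiples_le]; show L c = c; rw [← hL, hc])
    show L w = w
    rw [← hL, hW w hw]
  intro x hx
  rw [hL]; exact hle hx

/-- Adding a coset `c + W` to a proper subset `T` of `W`, in odd prime exponent. An affine
permutation stabilising `T ∪ (c + W)` maps `c + W` to a coset of `W` contained in `T ∪ (c + W)`, and
`c + W` is the only one; so it stabilises `T` as well. -/
theorem Pins.union_coset [Finite V] {q : ℕ} (hq : q.Prime) (hq2 : q ≠ 2) (hV : ∀ v : V, q • v = 0)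
    {T : Set V} {W : AddSubgroup V} (hTW : T ⊂ W) (hT : Pins (fun n => n ≠ 2 ∧ n ≠ q) T W) {c : V}
    (hc : c ∉ W) :
    Pins (fun n => n ≠ 2 ∧ n ≠ q) (T ∪ {x | x - c ∈ W}) (W ⊔ AddSubgroup.zmultiples c) := by
  intro g hg hgT
  obtain ⟨L, hL⟩ := id hg
  have h2 : ∀ b : V, 2 • b ∈ W → b ∈ W := fun b hb =>
    mem_of_nsmul_mem ((Nat.coprime_primes Nat.prime_two hq).2 (Ne.symm hq2)) hV hb
  have hU : ∀ x, x - c ∈ W → g x ∈ W ∨ g x - c ∈ W := fun x hx =>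
    ((hgT x).2 (Or.inr hx)).imp (fun h => hTW.1 h) id
  -- `g c`, `g (c + w)`, `g (c - w)` lie in the two cosets `W` and `c + W`, so two of them are
  -- congruent modulo `W`; they differ by `L w` or `2 • L w`
  have hLW : ∀ w ∈ W, L w ∈ W := by
    intro w hw
    have e0 := hU c (by simp)
    have e1 := hU (c + w) (by simpa using hw)
    have e2 := hU (c - w) (by simpa using hw)
    have f1 : g (c + w) = g c + L w := by rw [hL, hL c, map_add]; abel
    have f2 : g (c - w) = g c - L w := by rw [hL, hL c, map_sub]; abel
    rw [f1] at e1
    rw [f2] at e2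
    have k1 : ∀ a : V, a ∈ W → a + L w ∈ W → L w ∈ W := fun a h h' => by
      simpa using sub_mem h' h
    have k2 : ∀ a : V, a ∈ W → a - L w ∈ W → L w ∈ W := fun a h h' => by
      simpa using sub_mem h h'
    have k3 : ∀ a : V, a + L w ∈ W → a - L w ∈ W → L w ∈ W := fun a h h' => by
      have := sub_mem h h'
      exact h2 _ (by convert this using 1; rw [two_nsmul]; abel)
    rw [show g c + L w - c = (g c - c) + L w by abel] at e1
    rw [show g c - L w - c = (g c - c) - L w by abel] at e2
    rcases e0 with e0 | e0 <;> rcases e1 with e1 | e1 <;> rcases e2 with e2 | e2 <;>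
      first | exact k1 _ e0 e1 | exact k2 _ e0 e2 | exact k3 _ e1 e2
  have hgc : g c - c ∈ W := by
    rcases hU c (by simp) with h | h
    · -- otherwise `g` maps `c + W` onto `W`, but a point of `W` outside `T` is not available
      exfalso
      have hcos : ∀ x, x - c ∈ W ↔ g x ∈ W := by
        have hLi : ∀ x, L x ∈ W ↔ x ∈ W := by
          have hinj : Function.Injective L := fun a b hab => g.injective (by rw [hL, hL b, hab])
          exact apply_mem_iff_of_mapsTo
            (g := Equiv.ofBijective L (Finite.injective_iff_bijective.1 hinj)) hLW
        intro x
        rw [← hLi, map_sub]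
        have : g x = (L x - L c) + g c := by rw [hL, hL c]; abel
        rw [this]
        exact (W.add_mem_cancel_right h).symm
      obtain ⟨x, hxW, hxT⟩ := Set.exists_of_ssubset hTW
      have hx := (hcos (g.symm x)).2 (by simpa using hxW)
      have := (hgT (g.symm x)).2 (Or.inr hx)
      rw [Equiv.apply_symm_apply] at this
      rcases this with h' | h'
      · exact hxT h'
      · exact hc (by simpa using sub_mem hxW h')
    · exact h
  have hcos : ∀ x, g x ∈ {x | x - c ∈ W} ↔ x ∈ {x | x - c ∈ W} := by
    refine apply_mem_iff_of_mapsTo fun x hx => ?_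
    have : g x - c = L (x - c) + (g c - c) := by rw [hL, hL c, map_sub]; abel
    rw [Set.mem_ofPred_eq, this]
    exact add_mem (hLW _ hx) hgc
  have hdis : ∀ x, x ∈ T → x ∉ {x | x - c ∈ W} := fun x hx hx' =>
    hc (by simpa using sub_mem (hTW.1 hx : x ∈ W) hx')
  have hgT' : ∀ x, g x ∈ T ↔ x ∈ T := by
    intro x
    have a := hgT x
    have b := hcos x
    have c1 := hdis x
    have c2 := hdis (g x)
    simp only [Set.mem_union] at a
    tauto
  obtain ⟨hW, hfix⟩ := hT g hg hgT'
  refine ⟨mapsTo_sup_zmultiples hg hW ?_, fun n hn hnq hgn => ?_⟩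
  · rw [← sub_add_cancel (g c) c]
    exact add_mem (AddSubgroup.mem_sup_left hgc)
      (AddSubgroup.mem_sup_right (AddSubgroup.mem_zmultiples c))
  · have hfix' := hfix n hn hnq hgn
    exact fixed_sup_zmultiples hg hfix' (fixed_of_fixed_subgroup
      ((Nat.coprime_primes hn hq).2 hnq.2) hV hg hfix' hgn hgc)

theorem mem_sup_zmultiples_iff_of_two {W : AddSubgroup V} (hV : ∀ v : V, 2 • v = 0) {c x : V} :
    x ∈ W ⊔ AddSubgroup.zmultiples c ↔ x ∈ W ∨ x - c ∈ W := by
  constructor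
  · intro hx
    obtain ⟨w, hw, y, hy, rfl⟩ := AddSubgroup.mem_sup.1 hx
    obtain ⟨k, rfl⟩ := AddSubgroup.mem_zmultiples_iff.1 hy
    have h2 : (2 : ℤ) • c = 0 := by exact_mod_cast hV c
    rcases Int.even_or_odd' k with ⟨m, rfl | rfl⟩
    · left; rw [mul_comm, mul_smul, h2]; simpa using hw
    · right; rw [add_smul, mul_comm, mul_smul, h2]; simpa using hw
  · rintro (h | h)
    · exact AddSubgroup.mem_sup_left h
    · rw [← sub_add_cancel x c]
      exact add_mem (AddSubgroup.mem_sup_left h)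
        (AddSubgroup.mem_sup_right (AddSubgroup.mem_zmultiples c))

/-- Passing to the complement of a proper subset `T` of `W` in the next larger subgroup `W'`, in
exponent two. The complement contains `c + W` and a point of `W`, hence generates `W'` under the
operation `a + b - c`, which affine permutations preserve; so an affine permutation stabilising the
complement stabilises `W'` and `T`. -/
theorem Pins.compl_two [Finite V] (hV : ∀ v : V, 2 • v = 0)
    {T : Set V} {W : AddSubgroup V} (hTW : T ⊂ W) (hT : Pins (fun n => 5 ≤ n) T W) {c : V}
    (hc : c ∉ W) :
    Pins (fun n => 5 ≤ n) ((W ⊔ AddSubgroup.zmultiples c : AddSubgroup V) \ T)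
      (W ⊔ AddSubgroup.zmultiples c) := by
  intro g hg hgT
  set W' := W ⊔ AddSubgroup.zmultiples c with hW'
  obtain ⟨u, huW, huT⟩ := Set.exists_of_ssubset hTW
  have hle : W ≤ W' := le_sup_left
  have hcW' : c ∈ W' := AddSubgroup.mem_sup_right (AddSubgroup.mem_zmultiples c)
  have hout : ∀ x ∈ W', x ∉ W → g x ∈ W' := fun x hx hxW =>
    ((hgT x).2 ⟨hx, fun h => hxW (hTW.1 h)⟩).1
  have hmaps : ∀ x ∈ W', g x ∈ W' := by
    intro x hx
    by_cases hxW : x ∈ W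
    · have h1 : g u ∈ W' := ((hgT u).2 ⟨hle huW, huT⟩).1
      have h2 : g (c + (x - u)) ∈ W' := hout _ (add_mem hcW' (sub_mem hx (hle huW)))
        (fun h => hc (by simpa using sub_mem h (sub_mem hxW huW)))
      have h3 := hg.apply_add_sub u (c + (x - u)) c
      rw [show u + (c + (x - u)) - c = x by abel] at h3
      rw [h3]
      exact sub_mem (add_mem h1 h2) (hout c hcW' hc)
    · exact hout x hx hxW
  have hgT' : ∀ x, g x ∈ T ↔ x ∈ T := by
    intro x
    have a := hgT x
    have b := apply_mem_iff_of_mapsTo (S := (W' : Set V)) hmaps x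
    have c1 : x ∈ T → x ∈ (W' : Set V) := fun h => hle (hTW.1 h)
    have c2 : g x ∈ T → g x ∈ (W' : Set V) := fun h => hle (hTW.1 h)
    simp only [Set.mem_sdiff] at a
    tauto
  obtain ⟨hW, hfix⟩ := hT g hg hgT'
  refine ⟨hmaps, fun n hn hnq hgn => ?_⟩
  have hfix' := hfix n hn hnq hgn
  have hgc : g c - c ∈ W := by
    rcases (mem_sup_zmultiples_iff_of_two hV).1 (hmaps c hcW') with h | h
    · exact absurd ((apply_mem_iff_of_mapsTo (S := (W : Set V)) hW c).1 h) hc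
    · exact h
  exact fixed_sup_zmultiples hg hfix' (fixed_of_fixed_subgroup
      ((Nat.coprime_primes hn Nat.prime_two).2 (by omega)) hV hg hfix' hgn hgc)

/-- If pinning sets can be passed on from each subgroup to the next larger one, then some nonempty
proper subset pins the whole group. -/
theorem exists_pins_top [Finite V] {P : ℕ → Prop} {T₀ : Set V} {W₀ : AddSubgroup V}
    (h₀ : T₀.Nonempty) (h₁ : T₀ ⊂ W₀) (h₂ : Pins P T₀ W₀)
    (step : ∀ (T : Set V) (W : AddSubgroup V) (c : V), T.Nonempty → T ⊂ W → Pins P T W → c ∉ W →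
      ∃ T' : Set V, T'.Nonempty ∧ T' ⊂ ((W ⊔ AddSubgroup.zmultiples c : AddSubgroup V) : Set V) ∧
        Pins P T' (W ⊔ AddSubgroup.zmultiples c)) :
    ∃ T : Set V, T.Nonempty ∧ T ≠ Set.univ ∧ Pins P T ⊤ := by
  obtain ⟨W, hW⟩ := Set.Finite.exists_maximal
    (s := {W : AddSubgroup V | ∃ T : Set V, T.Nonempty ∧ T ⊂ W ∧ Pins P T W})
    (Set.toFinite _) ⟨W₀, T₀, h₀, h₁, h₂⟩
  obtain ⟨T, hT0, hTW, hT⟩ := hW.prop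
  have htop : W = ⊤ := by
    by_contra hne
    obtain ⟨c, hc⟩ : ∃ c, c ∉ W := by
      by_contra! h
      exact hne (eq_top_iff.2 fun x _ => h x)
    have := hW.le_of_ge (step T W c hT0 hTW hT hc) le_sup_left
    exact hc (this (AddSubgroup.mem_sup_right (AddSubgroup.mem_zmultiples c)))
  subst htop
  exact ⟨T, hT0, by simpa using hTW.ne, hT⟩

theorem pins_pair {P : ℕ → Prop} (hP : ∀ n, n.Prime → P n → n ≠ 2) (c : V) :
    Pins P {0, c} (AddSubgroup.zmultiples c) := by
  classical
  intro g hg hgT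
  have h0 : g 0 ∈ AddSubgroup.zmultiples c ∧ g c ∈ AddSubgroup.zmultiples c := by
    have a := (hgT 0).2 (by simp)
    have b := (hgT c).2 (by simp)
    constructor
    · rcases a with a | a <;> rw [a] <;> simp
    · rcases b with b | b <;> rw [b] <;> simp
  obtain ⟨L, hL⟩ := id hg
  constructor
  · intro x hx
    obtain ⟨k, rfl⟩ := AddSubgroup.mem_zmultiples_iff.1 hx
    have hLc : L c ∈ AddSubgroup.zmultiples c := by
      have := sub_mem h0.2 h0.1
      rwa [hL c, add_sub_cancel_right] at this
    rw [hL, map_zsmul]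
    exact add_mem (zsmul_mem hLc _) h0.1
  · intro n hn hPn hgn x hx
    have hcard : ({0, c} : Finset V).card < n :=
      lt_of_le_of_lt Finset.card_le_two (lt_of_le_of_ne hn.two_le (hP n hn hPn).symm)
    have hF : ∀ x ∈ ({0, c} : Finset V), g x ∈ ({0, c} : Finset V) := fun x hx => by
      simpa using (hgT x).2 (by simpa using hx)
    have f0 := fixed_of_pow_eq_one hn hgn _ hcard hF (x := 0) (by simp)
    have fc := fixed_of_pow_eq_one hn hgn _ hcard hF (x := c) (by simp)
    exact fixed_sup_zmultiples (W := ⊥) hg (by simpa using f0) fc x (by simpa using hx)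

/-- Three affinely independent points of an elementary abelian `2`-group. Their sum is fixed
along with the set, whence the subgroup they generate is. -/
theorem pins_triple (hV : ∀ v : V, 2 • v = 0) {c d : V} (hc : c ≠ 0) (hd : d ≠ 0)
    (hcd : d ≠ c) :
    Pins (fun n => 5 ≤ n) {0, c, d} (AddSubgroup.zmultiples c ⊔ AddSubgroup.zmultiples d) := by
  classical
  intro g hg hgT
  have hmem : ∀ x : V, x ∈ AddSubgroup.zmultiples c ⊔ AddSubgroup.zmultiples d ↔
      x = 0 ∨ x = c ∨ x = d ∨ x = c + d := by
    intro x
    have h1 : ∀ y : V, y ∈ AddSubgroup.zmultiples c ↔ y = 0 ∨ y = c := fun y => by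
      have := mem_sup_zmultiples_iff_of_two (W := ⊥) hV (c := c) (x := y)
      rwa [bot_sup_eq, AddSubgroup.mem_bot, AddSubgroup.mem_bot, sub_eq_zero] at this
    rw [mem_sup_zmultiples_iff_of_two hV, h1, h1, sub_eq_zero, sub_eq_iff_eq_add, or_assoc]
  have a0 : g 0 = 0 ∨ g 0 = c ∨ g 0 = d := by simpa using (hgT 0).2 (by simp)
  have ac : g c = 0 ∨ g c = c ∨ g c = d := by simpa using (hgT c).2 (by simp)
  have ad : g d = 0 ∨ g d = c ∨ g d = d := by simpa using (hgT d).2 (by simp)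
  have n1 : g 0 ≠ g c := fun h => hc (g.injective h).symm
  have n2 : g 0 ≠ g d := fun h => hd (g.injective h).symm
  have n3 : g d ≠ g c := fun h => hcd (g.injective h)
  have hneg : ∀ v : V, -v = v := fun v => by
    rw [neg_eq_iff_add_eq_zero, ← two_nsmul, hV]
  have hsum : g (c + d) = c + d := by
    have := hg.apply_add_sub c d 0
    rw [sub_zero] at this
    rw [this, sub_eq_add_neg, hneg]
    rcases a0 with a0 | a0 | a0 <;> rcases ac with ac | ac | ac <;>
      rcases ad with ad | ad | ad <;> rw [a0, ac] at n1 <;> rw [a0, ad] at n2 <;>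
      rw [ad, ac] at n3 <;> first
        | exact (n1 rfl).elim
        | exact (n2 rfl).elim
        | exact (n3 rfl).elim
        | (rw [a0, ac, ad]; abel)
  constructor
  · intro x hx
    rw [hmem] at hx ⊢
    rcases hx with rfl | rfl | rfl | rfl <;> tauto
  · intro n hn hPn hgn x hx
    have hcard : ({0, c, d} : Finset V).card < n :=
      lt_of_le_of_lt Finset.card_le_three (by omega)
    have hF : ∀ x ∈ ({0, c, d} : Finset V), g x ∈ ({0, c, d} : Finset V) := fun x hx => by
      simpa using (hgT x).2 (by simpa using hx)
    rcases (hmem x).1 hx with rfl | rfl | rfl | rfl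
    · exact fixed_of_pow_eq_one hn hgn _ hcard hF (by simp)
    · exact fixed_of_pow_eq_one hn hgn _ hcard hF (by simp)
    · exact fixed_of_pow_eq_one hn hgn _ hcard hF (by simp)
    · exact hsum

theorem exists_pins_top_odd [Finite V] [Nontrivial V] {q : ℕ} (hq : q.Prime) (hq2 : q ≠ 2)
    (hV : ∀ v : V, q • v = 0) :
    ∃ T : Set V, T.Nonempty ∧ T ≠ Set.univ ∧ Pins (fun n => n ≠ 2 ∧ n ≠ q) T ⊤ := by
  have h2 : ∀ (W : AddSubgroup V) (b : V), 2 • b ∈ W → b ∈ W := fun W b hb =>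
    mem_of_nsmul_mem ((Nat.coprime_primes Nat.prime_two hq).2 (Ne.symm hq2)) hV hb
  obtain ⟨c, hc⟩ := exists_ne (0 : V)
  refine exists_pins_top (T₀ := {0, c}) (W₀ := AddSubgroup.zmultiples c) ⟨0, by simp⟩ ?_
    (pins_pair (fun n _ h => h.1) c) ?_
  · rw [Set.ssubset_iff_of_subset (by rintro x (rfl | rfl) <;> simp)]
    refine ⟨2 • c, nsmul_mem (AddSubgroup.mem_zmultiples c) 2, ?_⟩
    rintro (h | h)
    · exact hc (by simpa using h2 ⊥ c (by simp [h]))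
    · rw [Set.mem_singleton_iff, two_nsmul, add_eq_left] at h
      exact hc h
  · intro T W c _ hTW hT hcW
    have hcW' : c ∈ W ⊔ AddSubgroup.zmultiples c :=
      AddSubgroup.mem_sup_right (AddSubgroup.mem_zmultiples c)
    refine ⟨_, ⟨c, Or.inr (by simp)⟩, ?_, hT.union_coset hq hq2 hV hTW hcW⟩
    rw [Set.ssubset_iff_of_subset]
    · -- the coset of `2 • c` is left out
      refine ⟨2 • c, nsmul_mem hcW' 2, ?_⟩
      rintro (h | h)
      · exact hcW (h2 W c (hTW.1 h))
      · exact hcW (by simpa [two_nsmul] using h)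
    · rintro x (h | h)
      · exact AddSubgroup.mem_sup_left (hTW.1 h)
      · rw [← sub_add_cancel x c]
        exact add_mem (AddSubgroup.mem_sup_left h) hcW'

theorem exists_pins_top_two [Finite V] [Nontrivial V] (hV : ∀ v : V, 2 • v = 0) :
    ∃ T : Set V, T.Nonempty ∧ T ≠ Set.univ ∧ Pins (fun n => 5 ≤ n) T ⊤ := by
  obtain ⟨c, hc⟩ := exists_ne (0 : V)
  by_cases hV2 : ∀ d : V, d = 0 ∨ d = c
  · -- a group of order two has no room for three points, but a single one will do
    refine ⟨{0}, by simp, fun h => hc (by simpa using Set.eq_univ_iff_forall.1 h c), ?_⟩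
    intro g hg hgT
    have h0 : g 0 = 0 := by simpa using (hgT 0).2 (by simp)
    refine ⟨fun _ _ => trivial, fun n _ _ _ x _ => ?_⟩
    rcases hV2 x with rfl | rfl
    · exact h0
    · exact (hV2 (g x)).resolve_left fun h => hc (g.injective (by rw [h, h0]))
  · push Not at hV2
    obtain ⟨d, hd, hdc⟩ := hV2
    refine exists_pins_top (T₀ := {0, c, d})
      (W₀ := AddSubgroup.zmultiples c ⊔ AddSubgroup.zmultiples d) ⟨0, by simp⟩ ?_
      (pins_triple hV hc hd hdc) ?_
    · have h1 : c ∈ AddSubgroup.zmultiples c ⊔ AddSubgroup.zmultiples d :=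
        AddSubgroup.mem_sup_left (AddSubgroup.mem_zmultiples c)
      have h2 : d ∈ AddSubgroup.zmultiples c ⊔ AddSubgroup.zmultiples d :=
        AddSubgroup.mem_sup_right (AddSubgroup.mem_zmultiples d)
      rw [Set.ssubset_iff_of_subset (by
        rintro x (rfl | rfl | rfl)
        · exact zero_mem _
        · exact h1
        · exact h2)]
      refine ⟨c + d, add_mem h1 h2, ?_⟩
      rintro (h | h | h)
      · exact hdc (by
          rw [← neg_eq_iff_add_eq_zero] at h
          rw [← h, neg_eq_iff_add_eq_zero, ← two_nsmul, hV])
      · exact hd (by simpa using h)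
      · exact hc (by simpa using h)
    · intro T W c hT0 hTW hT hcW
      obtain ⟨t, ht⟩ := hT0
      refine ⟨((W ⊔ AddSubgroup.zmultiples c : AddSubgroup V) : Set V) \ T,
        ⟨c, AddSubgroup.mem_sup_right (AddSubgroup.mem_zmultiples c),
        fun h => hcW (hTW.1 h)⟩, ?_, hT.compl_two hV hTW hcW⟩
      rw [Set.ssubset_iff_of_subset Set.sdiff_subset]
      exact ⟨t, AddSubgroup.mem_sup_left (hTW.1 ht), fun h => h.2 ht⟩

end Affine

/-! ### Bookkeeping of prime divisors -/

/-- Every prime divisor of `a` divides `b`, up to one exception in `{2, 3}`, which is not allowed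
if `a` is odd. -/
def NearlyCovers (a b : ℕ) : Prop :=
  (∃ p ∈ ({2, 3} : Finset ℕ), ∀ r, r.Prime → r ∣ a → r ∣ b ∨ r = p) ∧
    (Odd a → ∀ r, r.Prime → r ∣ a → r ∣ b)

/-- If `b₁` misses the divisor `3` of `a₁`, then `a₁` is even and `b₁` is even, too, so that it does
not matter if `b₂` misses `2`. Hence `b` misses at most one of the two primes. -/
theorem NearlyCovers.combine {a₁ a₂ a b₁ b₂ b : ℕ} (h₁ : NearlyCovers a₁ b₁)
    (h₂ : NearlyCovers a₂ b₂) (hb₁ : b₁ ∣ b) (hb₂ : b₂ ∣ b) (ha₁ : a₁ ∣ a) (ha₂ : a₂ ∣ a)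
    (ha : ∀ r, r.Prime → r ∣ a → r ∣ a₁ ∨ r ∣ a₂) : NearlyCovers a b := by
  have key : ∀ {a b : ℕ}, NearlyCovers a b →
      (∀ r, r.Prime → r ∣ a → r ∣ b ∨ r = 2) ∨
        (2 ∣ b ∧ ∀ r, r.Prime → r ∣ a → r ∣ b ∨ r = 3) := by
    rintro a b ⟨⟨p, hp, hpr⟩, hodd⟩
    rcases Nat.even_or_odd a with he | ho
    · rcases Finset.mem_insert.1 hp with rfl | hp
      · exact Or.inl hpr
      · rw [Finset.mem_singleton] at hp
        subst hp
        exact Or.inr ⟨(hpr 2 Nat.prime_two he.two_dvd).resolve_right (by norm_num), hpr⟩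
    · exact Or.inl fun r hr hra => Or.inl (hodd ho r hr hra)
  constructor
  · have main : ∀ p, (∀ r, r.Prime → r ∣ a₁ → r ∣ b ∨ r = p) →
        (∀ r, r.Prime → r ∣ a₂ → r ∣ b ∨ r = p) → ∀ r, r.Prime → r ∣ a → r ∣ b ∨ r = p :=
      fun p k₁ k₂ r hr hra => (ha r hr hra).elim (k₁ r hr) (k₂ r hr)
    rcases key h₁ with k₁ | ⟨e₁, k₁⟩ <;> rcases key h₂ with k₂ | ⟨e₂, k₂⟩
    · exact ⟨2, by simp, main 2 (fun r hr h => (k₁ r hr h).imp_left fun h => h.trans hb₁)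
        (fun r hr h => (k₂ r hr h).imp_left fun h => h.trans hb₂)⟩
    · refine ⟨3, by simp, main 3 (fun r hr h => ?_)
        (fun r hr h => (k₂ r hr h).imp_left fun h => h.trans hb₂)⟩
      rcases k₁ r hr h with h | rfl
      · exact Or.inl (h.trans hb₁)
      · exact Or.inl (e₂.trans hb₂)
    · refine ⟨3, by simp, main 3 (fun r hr h => (k₁ r hr h).imp_left fun h => h.trans hb₁)
        (fun r hr h => ?_)⟩
      rcases k₂ r hr h with h | rfl
      · exact Or.inl (h.trans hb₂)
      · exact Or.inl (e₁.trans hb₁)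
    · exact ⟨3, by simp, main 3 (fun r hr h => (k₁ r hr h).imp_left fun h => h.trans hb₁)
        (fun r hr h => (k₂ r hr h).imp_left fun h => h.trans hb₂)⟩
  · intro ho r hr hra
    rcases ha r hr hra with h | h
    · exact (h₁.2 (ho.of_dvd_nat ha₁) r hr h).trans hb₁
    · exact (h₂.2 (ho.of_dvd_nat ha₂) r hr h).trans hb₂

/-! ### Group-theoretic preliminaries -/

theorem Subgroup.relIndex_dvd_index_of_normal_right {G : Type*} [Group G] [Finite G]
    (H K : Subgroup G) [K.Normal] : H.relIndex K ∣ H.index := by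
  have h1 : H.relIndex K * K.relIndex (H ⊔ K) = H.relIndex (H ⊔ K) * K.relIndex H := by
    have e1 := Subgroup.relIndex_mul_relIndex (H ⊓ K) K (H ⊔ K) inf_le_right le_sup_right
    have e2 := Subgroup.relIndex_mul_relIndex (H ⊓ K) H (H ⊔ K) inf_le_left le_sup_left
    rw [Subgroup.inf_relIndex_right] at e1
    rw [Subgroup.inf_relIndex_left] at e2
    rw [e1, ← e2, mul_comm]
  rw [Subgroup.relIndex_sup_right] at h1
  have h2 : H.relIndex K = H.relIndex (H ⊔ K) :=
    Nat.eq_of_mul_eq_mul_right (Nat.pos_of_ne_zero (Subgroup.index_ne_zero_of_finite)) h1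
  rw [h2]
  exact Dvd.intro _ (Subgroup.relIndex_mul_index le_sup_left)

/-- An element of order `r` modulo a normal subgroup makes `r` a divisor of the index. -/
theorem Subgroup.dvd_index_of_pow_mem {G : Type*} [Group G] (C : Subgroup G) [C.Normal] {r : ℕ}
    (hr : r.Prime) {x : G} (hx : x ^ r ∈ C) (hxC : x ∉ C) : r ∣ C.index := by
  have := Fact.mk hr
  have h1 : orderOf (QuotientGroup.mk' C x) = r :=
    orderOf_eq_prime ((QuotientGroup.eq_one_iff (N := C) (x ^ r)).2 hx)
      fun h => hxC ((QuotientGroup.eq_one_iff (N := C) x).1 h)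
  have h2 := _root_.orderOf_dvd_natCard (QuotientGroup.mk' C x)
  rwa [h1, ← Subgroup.index_eq_card] at h2

theorem Subgroup.exists_mem_orderOf_eq_of_not_dvd_index {G : Type*} [Group G] [Finite G]
    (S : Subgroup G) {r : ℕ} (hr : r.Prime) (h : r ∣ Nat.card G) (hS : ¬ r ∣ S.index) :
    ∃ x ∈ S, orderOf x = r := by
  have := Fact.mk hr
  rw [← S.card_mul_index] at h
  obtain ⟨x, hx⟩ := exists_prime_orderOf_dvd_card' r ((hr.dvd_mul.1 h).resolve_right hS)
  exact ⟨x, x.2, by rw [Subgroup.orderOf_coe, hx]⟩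

/-- The subgroup consists of the elements of order dividing `q` in the last nontrivial term of the
derived series. -/
theorem exists_normal_elementary_abelian {G : Type*} [Group G] [Finite G] [Nontrivial G]
    [hG : Group.IsSolvable G] :
    ∃ q : ℕ, q.Prime ∧ ∃ N : Subgroup G, N.Normal ∧ N ≠ ⊥ ∧ (∀ a ∈ N, ∀ b ∈ N, a * b = b * a) ∧
      ∀ a ∈ N, a ^ q = 1 := by
  obtain ⟨A, hAn, hA, hAc⟩ : ∃ A : Subgroup G, A.Normal ∧ A ≠ ⊥ ∧ ∀ a ∈ A, ∀ b ∈ A,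
      a * b = b * a := by
    classical
    have hex : ∃ n, derivedSeries G n = ⊥ := hG.solvable
    obtain ⟨m, hm⟩ : ∃ m, Nat.find hex = m + 1 := by
      refine Nat.exists_eq_succ_of_ne_zero fun h0 => ?_
      have := Nat.find_spec hex
      rw [h0, derivedSeries_zero] at this
      exact top_ne_bot this
    refine ⟨derivedSeries G m, inferInstance, Nat.find_min hex (by omega), ?_⟩
    have h := Nat.find_spec hex
    rw [hm, derivedSeries_succ] at h
    intro a ha b hb
    have := Subgroup.commutator_mem_commutator ha hb
    rw [h, Subgroup.mem_bot, commutatorElement_eq_one_iff_mul_comm] at this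
    exact this
  have hc : Nat.card A ≠ 1 := by rwa [Ne, Subgroup.card_eq_one]
  obtain ⟨q, hq, hqA⟩ := Nat.exists_prime_and_dvd hc
  have := Fact.mk hq
  let N : Subgroup G :=
    { carrier := {a | a ∈ A ∧ a ^ q = 1}
      one_mem' := ⟨A.one_mem, one_pow q⟩
      mul_mem' := fun {a b} ha hb =>
        ⟨A.mul_mem ha.1 hb.1, by
          rw [(show Commute a b from hAc a ha.1 b hb.1).mul_pow, ha.2, hb.2, one_mul]⟩
      inv_mem' := fun {a} ha => ⟨A.inv_mem ha.1, by rw [inv_pow, ha.2, inv_one]⟩ }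
  refine ⟨q, hq, N, ⟨fun a ha g => ⟨hAn.conj_mem a ha.1 g, ?_⟩⟩, ?_, fun a ha b hb =>
    hAc a ha.1 b hb.1, fun a ha => ha.2⟩
  · rw [conj_pow, ha.2, mul_one, mul_inv_cancel]
  · obtain ⟨x, hx⟩ := exists_prime_orderOf_dvd_card' q hqA
    intro hbot
    have hxN : (x : G) ∈ N := ⟨x.2, by rw [← hx, ← Subgroup.orderOf_coe, pow_orderOf_eq_one]⟩
    rw [hbot, Subgroup.mem_bot] at hxN
    rw [← Subgroup.orderOf_coe, hxN, orderOf_one] at hx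
    exact hq.one_lt.ne hx

/-! ### Subsets with many primes in their orbit lengths -/

section Actions

open MulAction

variable (G : Type*) (Ω : Type*) [Group G] [MulAction G Ω]

/-- Some nonempty subset of `Ω` has an orbit whose length is divisible by all prime divisors of the
order of the permutation group induced by `G`, up to the exceptions allowed by `NearlyCovers`. -/
def HasCoveringSubset : Prop :=
  ∃ Δ : Set Ω, Δ.Nonempty ∧ NearlyCovers (toPermHom G Ω).ker.index (stabilizer G Δ).index

variable {G Ω}

theorem mem_ker_toPermHom {g : G} : g ∈ (toPermHom G Ω).ker ↔ ∀ x : Ω, g • x = x := by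
  rw [MonoidHom.mem_ker, Equiv.Perm.ext_iff]; rfl

theorem index_ker_toPermHom_of_faithful [FaithfulSMul G Ω] :
    (toPermHom G Ω).ker.index = Nat.card G := by
  rw [(MonoidHom.ker_eq_bot_iff _).2 toPerm_injective, Subgroup.index_bot]

theorem HasCoveringSubset.of_range (h : HasCoveringSubset (toPermHom G Ω).range Ω) :
    HasCoveringSubset G Ω := by
  obtain ⟨Δ, hΔ, hc⟩ := h
  refine ⟨Δ, hΔ, ?_⟩
  rw [index_ker_toPermHom_of_faithful, ← Subgroup.index_ker, index_stabilizer] at hc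
  rw [index_stabilizer]
  convert hc using 2
  ext S
  constructor
  · rintro ⟨g, rfl⟩; exact ⟨⟨toPermHom G Ω g, g, rfl⟩, rfl⟩
  · rintro ⟨⟨_, g, rfl⟩, rfl⟩; exact ⟨g, rfl⟩

theorem index_stabilizer_smul (g : G) (x : Ω) :
    (stabilizer G (g • x)).index = (stabilizer G x).index := by
  rw [index_stabilizer, orbit_smul, ← index_stabilizer]

/-- An invariant subset, as a set acted on by the group. -/
def invariantSubMulAction (s : Set Ω) (h : ∀ g : G, ∀ x ∈ s, g • x ∈ s) : SubMulAction G Ω :=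
  ⟨s, fun g {x} hx => h g x hx⟩

/-- The intransitive case: subsets of two complementary invariant sets are united. -/
theorem HasCoveringSubset.of_compl [Finite G] (X Y : SubMulAction G Ω)
    (hXY : ∀ x : Ω, x ∈ X ↔ x ∉ Y)
    (hX : HasCoveringSubset G X) (hY : HasCoveringSubset G Y) : HasCoveringSubset G Ω := by
  have hst : ∀ (Z : SubMulAction G Ω) (D : Set Z) (E : Set Ω), (∀ z : Z, (z : Ω) ∈ E ↔ z ∈ D) →
      stabilizer G E ≤ stabilizer G D := by
    intro Z D E h g hg
    rw [mem_stabilizer_set] at hg ⊢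
    intro z
    rw [← h, ← h, SubMulAction.val_smul, hg]
  have hk : ∀ Z : SubMulAction G Ω, (toPermHom G Ω).ker ≤ (toPermHom G Z).ker := by
    intro Z g hg
    rw [mem_ker_toPermHom] at hg ⊢
    exact fun z => Subtype.ext (by rw [SubMulAction.val_smul, hg])
  obtain ⟨D, ⟨d, hd⟩, hDc⟩ := hX
  obtain ⟨E, -, hEc⟩ := hY
  refine ⟨{x | (∃ h : x ∈ X, ⟨x, h⟩ ∈ D) ∨ ∃ h : x ∈ Y, ⟨x, h⟩ ∈ E}, ⟨d, Or.inl ⟨d.2, hd⟩⟩,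
    hDc.combine hEc (Subgroup.index_dvd_of_le (hst X D _ fun z => ?_))
      (Subgroup.index_dvd_of_le (hst Y E _ fun z => ?_))
      (Subgroup.index_dvd_of_le (hk X)) (Subgroup.index_dvd_of_le (hk Y)) ?_⟩
  · have hz := (hXY z).1 z.2
    simp [hz]
  · have hz : (z : Ω) ∉ X := fun h => (hXY z).1 h z.2
    simp [hz]
  · have hker : (toPermHom G Ω).ker = (toPermHom G X).ker ⊓ (toPermHom G Y).ker := by
      refine le_antisymm (le_inf (hk X) (hk Y)) fun g hg => ?_
      rw [Subgroup.mem_inf, mem_ker_toPermHom, mem_ker_toPermHom] at hg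
      rw [mem_ker_toPermHom]
      intro x
      by_cases hx : x ∈ X
      · exact congrArg Subtype.val (hg.1 ⟨x, hx⟩)
      · exact congrArg Subtype.val (hg.2 ⟨x, by rw [hXY] at hx; exact not_not.1 hx⟩)
    intro r hr hra
    rw [hker, ← Subgroup.relIndex_mul_index (inf_le_right), Subgroup.inf_relIndex_right] at hra
    exact (hr.dvd_mul.1 hra).imp_left fun h =>
      h.trans (Subgroup.relIndex_dvd_index_of_normal _ _)

/-- The imprimitive case. In a system of blocks `B`, a subset `A ⊆ B` is inflated by putting a
translate of a fixed nonempty subset `S` of one block into each block that belongs to `A`. Its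
stabilizer stabilises `A`, and in the kernel of the action on the blocks it stabilises `S`. -/
theorem HasCoveringSubset.of_block [Finite G] [FaithfulSMul G Ω] [IsPretransitive G Ω]
    {b : Set Ω} (hb : IsBlock G b) (hbn : b.Nonempty)
    (X : SubMulAction (toPermHom G (orbit G b)).ker Ω) (hX : ∀ x, x ∈ X ↔ x ∈ b)
    (hB : HasCoveringSubset G (orbit G b))
    (hK : HasCoveringSubset (toPermHom G (orbit G b)).ker X) : HasCoveringSubset G Ω := by
  classical
  let K := (toPermHom G (orbit G b)).ker
  let β : orbit G b := ⟨b, mem_orbit_self b⟩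
  obtain ⟨A₁, ⟨a, ha⟩, hA₁⟩ := hB
  obtain ⟨S₁, hS₁, hSc⟩ := hK
  -- replacing `A₁` by a translate, the block `b` belongs to it
  obtain ⟨A, hβA, hA⟩ : ∃ A : Set (orbit G b), β ∈ A ∧
      NearlyCovers K.index (stabilizer G A).index := by
    obtain ⟨g, hg⟩ := exists_smul_eq G a β
    refine ⟨g • A₁, ⟨a, ha, hg⟩, ?_⟩
    exact (index_stabilizer_smul g A₁).symm ▸ hA₁
  have hex : ∀ c : orbit G b, ∃ g : G, g • β = c := fun c => exists_smul_eq G β c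
  choose t' ht' using hex
  let t : orbit G b → G := fun c => t' c * (t' β)⁻¹
  have ht : ∀ c, t c • β = c := fun c => by
    have h1 : (t' β)⁻¹ • β = β := by rw [inv_smul_eq_iff, ht']
    rw [mul_smul, h1, ht']
  have htβ : t β = 1 := mul_inv_cancel _
  let S : Set Ω := Subtype.val '' S₁
  have hSb : S ⊆ b := by rintro _ ⟨x, _, rfl⟩; exact (hX _).1 x.2
  have hSn : S.Nonempty := hS₁.image _
  have htS : ∀ c : orbit G b, t c • S ⊆ (c : Set Ω) := fun c => by
    have := Set.smul_set_mono (a := t c) hSb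
    have e : t c • b = (c : Set Ω) := congrArg Subtype.val (ht c)
    rwa [e] at this
  have hdisj : ∀ c d : orbit G b, ∀ x, x ∈ (c : Set Ω) → x ∈ (d : Set Ω) → c = d := by
    rintro ⟨_, g, rfl⟩ ⟨_, g', rfl⟩ x hx hx'
    exact Subtype.ext (hb.smul_eq_smul_of_nonempty ⟨x, hx, hx'⟩)
  let Δ : Set Ω := ⋃ c ∈ A, t c • S
  have hΔ : ∀ c : orbit G b, ∀ x, x ∈ (c : Set Ω) → (x ∈ Δ ↔ c ∈ A ∧ x ∈ t c • S) := by
    intro c x hx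
    simp only [Δ, Set.mem_iUnion, exists_prop]
    constructor
    · rintro ⟨d, hd, hxd⟩
      obtain rfl := hdisj c d x hx (htS d hxd)
      exact ⟨hd, hxd⟩
    · exact fun h => ⟨c, h⟩
  have hmeets : ∀ c : orbit G b, c ∈ A ↔ ∃ x ∈ (c : Set Ω), x ∈ Δ := by
    intro c
    constructor
    · intro hc
      obtain ⟨s, hs⟩ := hSn
      have h1 : t c • s ∈ t c • S := Set.smul_mem_smul_set hs
      exact ⟨t c • s, htS c h1, (hΔ c _ (htS c h1)).2 ⟨hc, h1⟩⟩
    · rintro ⟨x, hx, hxΔ⟩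
      exact ((hΔ c x hx).1 hxΔ).1
  have hΔS : ∀ x ∈ b, (x ∈ Δ ↔ x ∈ S) := by
    intro x hx
    rw [hΔ β x hx, htβ, one_smul]
    exact ⟨fun h => h.2, fun h => ⟨hβA, h⟩⟩
  have hstA : stabilizer G Δ ≤ stabilizer G A := by
    intro g hg
    rw [mem_stabilizer_set] at hg ⊢
    intro c
    rw [hmeets, hmeets]
    constructor
    · rintro ⟨_, ⟨x, hx, rfl⟩, hxΔ⟩
      exact ⟨x, hx, (hg x).1 hxΔ⟩
    · rintro ⟨x, hx, hxΔ⟩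
      exact ⟨g • x, ⟨x, hx, rfl⟩, (hg x).2 hxΔ⟩
  have hstS : (stabilizer G Δ).subgroupOf K ≤ stabilizer K S₁ := by
    intro k hk
    rw [Subgroup.mem_subgroupOf, mem_stabilizer_set] at hk
    rw [mem_stabilizer_set]
    have hval : ∀ x : X, x ∈ S₁ ↔ (x : Ω) ∈ Δ := fun x => by
      rw [hΔS _ ((hX _).1 x.2)]
      exact (Subtype.val_injective.mem_set_image).symm
    intro x
    rw [hval, hval]
    exact hk x
  have hidx : (stabilizer K S₁).index ∣ (stabilizer G Δ).index :=
    (Subgroup.index_dvd_of_le hstS).trans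
      (Subgroup.relIndex_dvd_index_of_normal_right (stabilizer G Δ) K)
  refine ⟨Δ, ?_, hA.combine hSc (Subgroup.index_dvd_of_le hstA) hidx ?_ ?_ ?_⟩
  · obtain ⟨x, _, hx⟩ := (hmeets β).1 hβA
    exact ⟨x, hx⟩
  · rw [index_ker_toPermHom_of_faithful (Ω := Ω)]; exact K.index_dvd_card
  · rw [index_ker_toPermHom_of_faithful (Ω := Ω)]
    exact (Subgroup.index_dvd_card _).trans K.card_subgroup_dvd_card
  · intro r hr hra
    rw [index_ker_toPermHom_of_faithful] at hra
    by_contra! hcon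
    obtain ⟨k, hkK, hk⟩ := K.exists_mem_orderOf_eq_of_not_dvd_index hr hra hcon.1
    -- `k` moves a point; conjugating, so does an element of the same order in the block `b`
    obtain ⟨x, hx⟩ : ∃ x : Ω, k • x ≠ x := by
      by_contra! h
      have : k = 1 := FaithfulSMul.eq_of_smul_eq_smul (α := Ω) fun x => by rw [h x, one_smul]
      rw [this, orderOf_one] at hk
      exact hr.one_lt.ne hk
    obtain ⟨y, hy⟩ := hbn
    obtain ⟨g, rfl⟩ := exists_smul_eq G y x
    have hkK' : g⁻¹ * k * g ∈ K := by
      have := (inferInstance : K.Normal).conj_mem k hkK g⁻¹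
      rwa [inv_inv] at this
    refine hcon.2 (Subgroup.dvd_index_of_pow_mem _ hr (x := ⟨g⁻¹ * k * g, hkK'⟩) ?_ ?_)
    · have h1 : (g⁻¹ * k * g) ^ r = 1 := by
        have := conj_pow (i := r) (a := g⁻¹) (b := k)
        rw [inv_inv] at this
        rw [this, ← hk, pow_orderOf_eq_one]; group
      have h2 : (⟨g⁻¹ * k * g, hkK'⟩ : K) ^ r = 1 := Subtype.ext h1
      rw [h2]
      exact one_mem _
    · intro h
      have := congrArg Subtype.val (mem_ker_toPermHom.1 h ⟨y, (hX y).2 hy⟩)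
      have h3 : (g⁻¹ * k * g) • y = y := this
      rw [mul_assoc, mul_smul, inv_smul_eq_iff, mul_smul] at h3
      exact hx h3

/-- The affine case: `Ω` is identified with the regular subgroup `N`. -/
theorem HasCoveringSubset.of_regular [Finite G] [FaithfulSMul G Ω] {q : ℕ} (hq : q.Prime)
    (N : Subgroup G) [N.Normal] (hN : N ≠ ⊥) (hcomm : ∀ a ∈ N, ∀ b ∈ N, a * b = b * a)
    (hexp : ∀ a ∈ N, a ^ q = 1) [IsPretransitive N Ω] [Nonempty Ω] :
    HasCoveringSubset G Ω := by
  obtain ⟨x₀⟩ := ‹Nonempty Ω›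
  let : CommGroup N := { (inferInstance : Group N) with
    mul_comm := fun a b => Subtype.ext (hcomm a a.2 b b.2) }
  have hreg : ∀ n ∈ N, n • x₀ = x₀ → n = 1 := by
    intro n hn h
    refine FaithfulSMul.eq_of_smul_eq_smul (α := Ω) fun x => ?_
    obtain ⟨m, rfl⟩ := exists_smul_eq N x₀ x
    rw [Subgroup.smul_def, ← mul_smul, hcomm n hn m m.2, mul_smul, h, one_smul]
  let e : Additive N ≃ Ω := Equiv.ofBijective (fun n => (n.toMul : G) • x₀) (by
    constructor
    · intro a b hab
      have hab' : (a.toMul : G) • x₀ = (b.toMul : G) • x₀ := hab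
      rw [← inv_smul_eq_iff, ← mul_smul] at hab'
      have := hreg _ (N.mul_mem (N.inv_mem b.toMul.2) a.toMul.2) hab'
      rw [inv_mul_eq_one] at this
      exact (Subtype.ext this.symm : a.toMul = b.toMul)
    · intro x
      obtain ⟨n, hn⟩ := exists_smul_eq N x₀ x
      exact ⟨Additive.ofMul n, hn⟩)
  have he : ∀ n : N, e (Additive.ofMul n) = (n : G) • x₀ := fun n => rfl
  have hV : ∀ v : Additive N, q • v = 0 := fun v =>
    (Subtype.ext (hexp v.toMul v.toMul.2) : v.toMul ^ q = 1)
  have : Nontrivial (Additive N) := (Subgroup.nontrivial_iff_ne_bot N).2 hN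
  let φ : G → Equiv.Perm (Additive N) := fun g => (e.trans (toPerm g)).trans e.symm
  have hφ : ∀ g v, e (φ g v) = g • e v := fun g v => by simp [φ]
  have haff : ∀ g, IsAffinePerm (φ g) := by
    intro g
    refine ⟨((MulAut.conjNormal g : N ≃* N).toMonoidHom).toAdditive, fun v => e.injective ?_⟩
    rw [hφ]
    have h0 := hφ g 0
    have h1 : e 0 = x₀ := by
      have := he 1
      rwa [Subgroup.coe_one, one_smul] at this
    rw [h1] at h0
    change g • (v.toMul : G) • x₀ =
      ((MulAut.conjNormal g v.toMul : N) * ((φ g 0).toMul : N) : G) • x₀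
    have h2 : ((φ g 0).toMul : G) • x₀ = g • x₀ := h0
    rw [mul_smul, h2, MulAut.conjNormal_apply, ← mul_smul, ← mul_smul]
    congr 1; group
  have hφpow : ∀ g n v, e ((φ g ^ n) v) = g ^ n • e v := by
    intro g n
    induction n with
    | zero => intro v; simp
    | succ n ih => intro v; rw [pow_succ', Equiv.Perm.mul_apply, hφ, ih, smul_smul, pow_succ']
  -- by Cauchy's theorem, a prime not dividing the orbit length is the order of some element of the
  -- stabilizer, and a pinned element is trivial
  have main : ∀ (P : ℕ → Prop) (T : Set (Additive N)), Pins P T ⊤ → ∀ r, r.Prime → P r →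
      r ∣ Nat.card G → r ∣ (stabilizer G (e '' T)).index := by
    intro P T hT r hr hPr hrG
    by_contra hcon
    obtain ⟨g, hg, hgr⟩ := Subgroup.exists_mem_orderOf_eq_of_not_dvd_index _ hr hrG hcon
    rw [mem_stabilizer_set] at hg
    have hgT : ∀ v, φ g v ∈ T ↔ v ∈ T := fun v => by
      rw [← e.injective.mem_set_image, hφ, hg, e.injective.mem_set_image]
    have hpow : φ g ^ r = 1 := Equiv.ext fun v => e.injective (by
      rw [hφpow, ← hgr, pow_orderOf_eq_one, one_smul]; rfl)
    have hfix := (hT (φ g) (haff g) hgT).2 r hr hPr hpow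
    have : g = 1 := FaithfulSMul.eq_of_smul_eq_smul (α := Ω) fun x => by
      rw [one_smul, ← e.apply_symm_apply x, ← hφ, hfix _ trivial]
    rw [this, orderOf_one] at hgr
    exact hr.one_lt.ne hgr
  -- `N` moves every proper nonempty subset, so that `q` divides its orbit length
  have hqdvd : ∀ T : Set (Additive N), T.Nonempty → T ≠ Set.univ →
      q ∣ (stabilizer G (e '' T)).index := by
    intro T hT0 hT1
    refine dvd_trans ?_ (Subgroup.relIndex_dvd_index_of_normal_right (stabilizer G (e '' T)) N)
    obtain ⟨t, ht⟩ := hT0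
    obtain ⟨n, hn⟩ : ∃ n : N, n ∉ (stabilizer G (e '' T)).subgroupOf N := by
      by_contra! h
      refine hT1 (Set.eq_univ_iff_forall.2 fun v => ?_)
      obtain ⟨n, hn⟩ := exists_smul_eq N (e t) (e v)
      have h1 := h n
      rw [Subgroup.mem_subgroupOf, mem_stabilizer_set] at h1
      have h2 := (h1 (e t)).2 (Set.mem_image_of_mem _ ht)
      have h3 : (n : G) • e t = e v := hn
      rwa [h3, e.injective.mem_set_image] at h2
    have : ((stabilizer G (e '' T)).subgroupOf N).Normal := inferInstance
    refine Subgroup.dvd_index_of_pow_mem _ hq (x := n) ?_ hn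
    have : n ^ q = 1 := Subtype.ext (hexp n n.2)
    rw [this]
    exact one_mem _
  have hqG : q ∣ Nat.card G := by
    obtain ⟨n, hn, hn1⟩ := N.bot_or_exists_ne_one.resolve_left hN
    have := Fact.mk hq
    rw [← orderOf_eq_prime (hexp n hn) hn1]
    exact orderOf_dvd_natCard n
  by_cases hq2 : q = 2
  · subst hq2
    obtain ⟨T, hT0, hT1, hT⟩ := exists_pins_top_two hV
    refine ⟨e '' T, hT0.image _, ⟨3, by simp, fun r hr hrG => ?_⟩, fun ho => ?_⟩
    · rw [index_ker_toPermHom_of_faithful] at hrG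
      by_cases h3 : r = 3
      · exact Or.inr h3
      by_cases h2 : r = 2
      · exact Or.inl (h2 ▸ hqdvd T hT0 hT1)
      have h4 : r ≠ 4 := by rintro rfl; exact absurd hr (by norm_num)
      have := hr.two_le
      exact Or.inl (main _ T hT r hr (show 5 ≤ r by omega) hrG)
    · rw [index_ker_toPermHom_of_faithful] at ho
      exact absurd hqG (by rwa [← even_iff_two_dvd, Nat.not_even_iff_odd])
  · obtain ⟨T, hT0, hT1, hT⟩ := exists_pins_top_odd hq hq2 hV
    have hr' : ∀ r, r.Prime → r ∣ (toPermHom G Ω).ker.index →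
        r ∣ (stabilizer G (e '' T)).index ∨ r = 2 := by
      intro r hr hrG
      rw [index_ker_toPermHom_of_faithful] at hrG
      by_cases h2 : r = 2
      · exact Or.inr h2
      by_cases hrq : r = q
      · exact Or.inl (hrq ▸ hqdvd T hT0 hT1)
      exact Or.inl (main _ T hT r hr ⟨h2, hrq⟩ hrG)
    refine ⟨e '' T, hT0.image _, ⟨2, by simp, hr'⟩, fun ho r hr hrG => ?_⟩
    refine (hr' r hr hrG).resolve_right ?_
    rintro rfl
    exact absurd hrG (by rwa [← even_iff_two_dvd, Nat.not_even_iff_odd])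

theorem HasCoveringSubset.of_subsingleton [Subsingleton G] [Nonempty Ω] :
    HasCoveringSubset G Ω := by
  have h : (toPermHom G Ω).ker.index = 1 := Subgroup.index_eq_one.2 (Subsingleton.elim _ _)
  have h' : ∀ r : ℕ, r.Prime → ¬ r ∣ 1 := fun r hr h => hr.one_lt.ne' (Nat.dvd_one.1 h)
  refine ⟨Set.univ, Set.univ_nonempty, ?_⟩
  rw [h]
  exact ⟨⟨2, by simp, fun r hr hr1 => absurd hr1 (h' r hr)⟩, fun _ r hr hr1 => absurd hr1 (h' r hr)⟩

end Actions

/-! ### Induction on the degree -/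

/-- Every action of a finite solvable group has a covering subset. The induction leads to actions
that need not be faithful; each is replaced by that of the induced permutation group. -/
theorem hasCoveringSubset_of_isSolvable.{u} (m : ℕ) : ∀ (G Ω : Type u) [Group G] [Finite G]
    [Group.IsSolvable G] [MulAction G Ω] [Finite Ω] [Nonempty Ω], Nat.card Ω = m →
    HasCoveringSubset G Ω := by
  induction m using Nat.strong_induction_on with
  | _ m ih =>
  intro G₀ Ω _ _ _ _ _ _ hm
  refine HasCoveringSubset.of_range ?_
  have : Group.IsSolvable (MulAction.toPermHom G₀ Ω).range :=
    Group.isSolvable_of_surjective (MulAction.toPermHom G₀ Ω).rangeRestrict_surjective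
  generalize (MulAction.toPermHom G₀ Ω).range = G at *
  have hlt : ∀ s : Set Ω, s ≠ Set.univ → Nat.card s < m := fun s hs => by
    rw [← hm, Nat.card_coe_set_eq, ← Set.ncard_univ]
    exact Set.ncard_lt_ncard (Set.ssubset_univ_iff.2 hs)
  by_cases htrans : MulAction.IsPretransitive G Ω
  · rcases subsingleton_or_nontrivial G with hG | hG
    · exact HasCoveringSubset.of_subsingleton
    obtain ⟨q, hq, N, hNn, hN, hcomm, hexp⟩ := exists_normal_elementary_abelian (G := G)
    by_cases hNt : MulAction.IsPretransitive N Ω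
    · exact HasCoveringSubset.of_regular hq N hN hcomm hexp
    -- `N` moves some point `x`, and the orbits of `N` are blocks
    obtain ⟨n, hnN, x, hx⟩ : ∃ n ∈ N, ∃ x : Ω, n • x ≠ x := by
      by_contra! h
      refine hN ((Subgroup.eq_bot_iff_forall N).2 fun n hn => ?_)
      exact FaithfulSMul.eq_of_smul_eq_smul (α := Ω) fun x => by rw [h n hn, one_smul]
    have hb : MulAction.IsBlock G (MulAction.orbit N x) := MulAction.IsBlock.orbit_of_normal x
    have hbn : (MulAction.orbit N x).Nonempty := ⟨x, MulAction.mem_orbit_self x⟩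
    have hbu : MulAction.orbit N x ≠ Set.univ := fun h =>
      hNt ((MulAction.isPretransitive_iff_orbit_eq_univ x).2 h)
    have hcard := hb.ncard_block_mul_ncard_orbit_eq hbn
    generalize hbdef : MulAction.orbit N x = b at *
    have h1 : 1 < b.ncard := by
      rw [Set.one_lt_ncard_iff]
      exact ⟨n • x, x, hbdef ▸ ⟨⟨n, hnN⟩, rfl⟩, hbdef ▸ MulAction.mem_orbit_self x, hx⟩
    let K := (MulAction.toPermHom G (MulAction.orbit G b)).ker
    let X : SubMulAction K Ω := invariantSubMulAction b fun k y hy => by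
      have h : (k : G) • b = b := congrArg Subtype.val
        (mem_ker_toPermHom.1 k.2 ⟨b, MulAction.mem_orbit_self b⟩)
      rw [← h]
      exact Set.smul_mem_smul_set hy
    have : Nonempty X := hbn.to_subtype
    have : Nonempty (MulAction.orbit G b) := (MulAction.nonempty_orbit b).to_subtype
    refine HasCoveringSubset.of_block hb hbn X (fun _ => Iff.rfl) ?_ ?_
    · refine ih _ ?_ G (MulAction.orbit G b) rfl
      rw [← hm, ← hcard, Nat.card_coe_set_eq]
      have : 0 < (MulAction.orbit G b).ncard :=
        (Set.ncard_pos (Set.toFinite _)).2 (MulAction.nonempty_orbit b)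
      nlinarith
    · exact ih _ (hlt b hbu) K X rfl
  · obtain ⟨x⟩ := ‹Nonempty Ω›
    have hO : MulAction.orbit G x ≠ Set.univ := fun h =>
      htrans ((MulAction.isPretransitive_iff_orbit_eq_univ x).2 h)
    let X : SubMulAction G Ω := invariantSubMulAction (MulAction.orbit G x) fun g y hy =>
      MulAction.mapsTo_smul_orbit g x hy
    let Y : SubMulAction G Ω := invariantSubMulAction (MulAction.orbit G x)ᶜ fun g y hy h =>
      hy (by simpa using MulAction.mapsTo_smul_orbit g⁻¹ x h)
    have : Nonempty X := ⟨⟨x, MulAction.mem_orbit_self x⟩⟩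
    have : Nonempty Y := (Set.nonempty_compl.2 hO).to_subtype
    refine HasCoveringSubset.of_compl X Y (fun y => (not_not).symm)
      (ih _ (hlt _ hO) G X rfl) (ih _ (hlt _ ?_) G Y rfl)
    exact fun h => (Set.eq_univ_iff_forall.1 h x) (MulAction.mem_orbit_self x)

theorem mainTheorem9 {Ω : Type*} [Finite Ω] [Nonempty Ω]
    (H : Subgroup (Equiv.Perm Ω)) (hH : Group.IsSolvable H) :
    ∃ Δ : Set Ω, Δ.Nonempty ∧
      (∃ p ∈ ({2, 3} : Finset ℕ),
        primesOfGroup H ⊆ primesOfIndex (MulAction.stabilizer H Δ) ∪ {p}) ∧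
      (Odd (Nat.card H) →
        primesOfGroup H = primesOfIndex (MulAction.stabilizer H Δ)) := by
  obtain ⟨Δ, hΔ, ⟨p, hp, hpr⟩, hodd⟩ := hasCoveringSubset_of_isSolvable _ H Ω rfl
  rw [index_ker_toPermHom_of_faithful] at hpr hodd
  have h0 : (MulAction.stabilizer H Δ).index ≠ 0 := Subgroup.index_ne_zero_of_finite
  refine ⟨Δ, hΔ, ⟨p, hp, fun r hr => ?_⟩, fun ho => Finset.Subset.antisymm (fun r hr => ?_) ?_⟩
  · have hr' := Nat.mem_primeFactors.1 hr
    rw [Finset.mem_union, Finset.mem_singleton]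
    exact (hpr r hr'.1 hr'.2.1).imp_left fun h => Nat.mem_primeFactors.2 ⟨hr'.1, h, h0⟩
  · have hr' := Nat.mem_primeFactors.1 hr
    exact Nat.mem_primeFactors.2 ⟨hr'.1, hodd ho r hr'.1 hr'.2.1, h0⟩
  · exact Nat.primeFactors_mono (Subgroup.index_dvd_card _) Nat.card_pos.ne'
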